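/- Let $d\ge 1$ and let $\mathbb{R}^d$ carry its Euclidean inner product $\langle\cdot,\cdot\rangle$. For $\theta\in S^{d-1}=\{z\in\mathbb{R}^d:|z|=1\}$ and $r\in[0,\infty)$ let $D_{\theta,r}=\{z\in\mathbb{R}^d:\langle\theta,z\rangle=r\}$. Let $d\theta$ be the surface measure on $S^{d-1}$ (the counting measure on $\{-1,1\}$ if $d=1$), and let $c_d=\frac12\int_{S^{d-1}}|\langle\theta,e\rangle|\,d\theta$, where $e$ is any unit vector. Let $\mathcal H^1$ be the one-dimensional Hausdorff measure on $\mathbb{R}^d$. Let $f:[0,1]\to\mathbb{R}^d$ be a continuous curve of finite length $L(f)$, with image $\operatorname{Im} f$. Then for every Borel set $A\subset \operatorname{Im} f$ the function $(\theta,r)\mapsto\operatorname{Card}(A\cap D_{\theta,r})\in\mathbb{N}\cup\{\infty\}$ is measurable on $S^{d-1}\times[0,\infty)$ for the completion of the product Borel $\sigma$-algebra with respect to $d\theta\,dr$, and $$\gamma(A)=\frac1{c_d}\int_{S^{d-1}}\int_0^\infty \operatorname{Card}(A\cap D_{\theta,r})\,dr\,d\theta$$ defines a measure $\gamma$ on the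 Borel subsets of $\operatorname{Im} f$. The trace of $\mathcal H^1$ on $\operatorname{Im} f$ satisfies $\mathcal H^1\le\gamma$, that is, $\mathcal H^1(A)\le\gamma(A)$ for every Borel set $A\subset\operatorname{Im} f$. If moreover $\mathcal H^1(\operatorname{Im} f)=L(f)$, then $\mathcal H^1=\gamma$ on $\operatorname{Im} f$, and $\operatorname{Card}(f^{-1}(\{y\}))=1$ for $\mathcal H^1$-almost every $y\in \operatorname{Im} f$. -/

import Mathlib

open MeasureTheory
open scoped ENNReal

noncomputable section

/-- The space `ℝ^d` with its Euclidean norm. -/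
abbrev EucSpace (d : ℕ) : Type := EuclideanSpace ℝ (Fin d)

/-- The unit sphere `S^{d-1}` of `ℝ^d`. -/
abbrev UnitSphere (d : ℕ) : Type := ↥(Metric.sphere (0 : EucSpace d) 1)

/-- The surface measure `dθ` on `S^{d-1}` (for `d = 1`: the counting measure on `{-1, 1}`). -/
def surfaceMeasure (d : ℕ) : Measure (UnitSphere d) :=
  (volume : Measure (EucSpace d)).toSphere

/-- The length `L(f)` of a curve `f : [0,1] → ℝ^d`: the supremum of the lengths of the inscribed
polygonal lines. -/
def curveLength {d : ℕ} (f : C(unitInterval, EucSpace d)) : ℝ≥0∞ :=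
  eVariationOn f Set.univ

/-- A curve is rectifiable if its length is finite. -/
def IsRectifiable {d : ℕ} (f : C(unitInterval, EucSpace d)) : Prop :=
  curveLength f < ∞

/-- The hyperplane `D_{θ,r} = {z | ⟨θ, z⟩ = r}`. -/
def hyperplane {d : ℕ} (θ : UnitSphere d) (r : ℝ) : Set (EucSpace d) :=
  {z | inner ℝ (θ : EucSpace d) z = r}

/-- `Card (A ∩ D_{θ,r})`, with value `∞` when the intersection is infinite. -/
def hyperplaneCount {d : ℕ} (A : Set (EucSpace d)) (θ : UnitSphere d) (r : ℝ) : ℝ≥0∞ :=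
  ((A ∩ hyperplane θ r).encard : ℝ≥0∞)

/-- The normalizing constant `c_d = (1/2) ∫_{S^{d-1}} |⟨θ, e⟩| dθ`, where `e` is a unit vector
(the first basis vector; by rotation invariance the choice does not matter). It is the constant for
which `L(f) = (1/c_d) ∫_{S^{d-1}} ∫_0^∞ Card {t | f t ∈ D_{θ,r}} dr dθ`; the factor `1/2` is there
because `r` ranges over the half-line `[0, ∞)` only: `D_{θ,r} = D_{-θ,-r}`. -/
def croftonConst (d : ℕ) [NeZero d] : ℝ≥0∞ :=
  (∫⁻ θ : UnitSphere d,
    ‖inner ℝ (θ : EucSpace d) (EuclideanSpace.single (0 : Fin d) (1 : ℝ))‖ₑ ∂(surfaceMeasure d)) / 2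

/-- `(1/c_d) ∫_{S^{d-1}} ∫_0^∞ Card (A ∩ D_{θ,r}) dr dθ`. -/
def croftonIntegral {d : ℕ} [NeZero d] (A : Set (EucSpace d)) : ℝ≥0∞ :=
  (croftonConst d)⁻¹ *
    ∫⁻ θ : UnitSphere d, (∫⁻ r in Set.Ici (0 : ℝ), hyperplaneCount A θ r) ∂(surfaceMeasure d)

end

open Set Filter Topology
open scoped NNReal Pointwise

/-! Averaged over the sphere, the projection of a vector `v` to a line has length `2 * croftonConst
d * ‖v‖` (`lintegral_enorm_inner`). The count of `A ∩ D_{θ,r}` is recovered from fine partitions of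
`A` by counting the pieces that the hyperplane meets, so everything reduces to the measure of the
hyperplanes hitting a small set. For a compact set this is half the averaged length of its
projections (`two_mul_lineMeasure_hitSet`).

Lower bound: an arc is connected, so its projections cover those of its chord, and γ(arc) is at
least the chord. Arcs of the image may overlap, so this cannot simply be summed in the image.
Instead, γ has a bounded density `ρ` with respect to the trace of the Hausdorff measure. Pulled back
to the arc-length parameter, the chord bounds do add up: `b - a ≤ ∫ x in a..b, ρ (g x)`. Lebesgue
differentiation gives `1 ≤ ρ ∘ g` almost everywhere, hence `1 ≤ ρ` almost everywhere on the image
(`IsArcLengthParam.restrict_hausdorffMeasure_le`).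

Upper bound: the area formula along the arc-length parametrization and Fatou's lemma give γ(Im f) ≤
L (`lintegral_hyperplaneCount_range_le`). If the Hausdorff measure of the image is also L, the two
ordered finite measures have equal mass and coincide. In that case two complementary arcs can only
overlap in a null set, which gives multiplicity one. -/

/-! ### Rotation invariance on the sphere and the constant `croftonConst` -/

instance isFiniteMeasure_surfaceMeasure (d : ℕ) : IsFiniteMeasure (surfaceMeasure d) := by
  unfold surfaceMeasure; infer_instance

/-- The action of a linear isometry on the unit sphere. -/
noncomputable def sphereMap {d : ℕ} (e : EucSpace d ≃ₗᵢ[ℝ] EucSpace d) (θ : UnitSphere d) :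
    UnitSphere d :=
  ⟨e θ, by simp⟩

lemma continuous_sphereMap {d : ℕ} (e : EucSpace d ≃ₗᵢ[ℝ] EucSpace d) :
    Continuous (sphereMap e) :=
  (e.continuous.comp continuous_subtype_val).subtype_mk _

lemma measurePreserving_sphereMap {d : ℕ} (e : EucSpace d ≃ₗᵢ[ℝ] EucSpace d) :
    MeasurePreserving (sphereMap e) (surfaceMeasure d) (surfaceMeasure d) := by
  refine ⟨(continuous_sphereMap e).measurable, Measure.ext fun s hs => ?_⟩
  have hm := (continuous_sphereMap e).measurable
  rw [Measure.map_apply hm hs, surfaceMeasure, Measure.toSphere_apply' _ hs,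
    Measure.toSphere_apply' _ (hm hs)]
  congr 1
  -- The surface measure of `s` is a multiple of the volume of the cone over `s`, and isometries
  -- commute with forming cones.
  have h : Ioo (0 : ℝ) 1 • ((↑) '' (sphereMap e ⁻¹' s) : Set (EucSpace d)) =
      e ⁻¹' (Ioo (0 : ℝ) 1 • ((↑) '' s)) := by
    ext y
    simp only [Set.mem_smul, mem_image, mem_preimage]
    constructor
    · rintro ⟨c, hc, _, ⟨θ, hθ, rfl⟩, rfl⟩
      exact ⟨c, hc, _, ⟨_, hθ, rfl⟩, by simp [sphereMap]⟩
    · rintro ⟨c, hc, _, ⟨θ, hθ, rfl⟩, h⟩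
      refine ⟨c, hc, _, ⟨sphereMap e.symm θ, ?_, rfl⟩, ?_⟩
      · have : sphereMap e (sphereMap e.symm θ) = θ := Subtype.ext (by simp [sphereMap])
        rwa [this]
      · apply e.injective
        rw [← h]
        simp [sphereMap]
  rw [h]
  exact e.measurePreserving.measure_preimage_emb e.toHomeomorph.measurableEmbedding _

lemma lintegral_sphereMap {d : ℕ} (e : EucSpace d ≃ₗᵢ[ℝ] EucSpace d) {F : UnitSphere d → ℝ≥0∞}
    (hF : Measurable F) :
    ∫⁻ θ, F (sphereMap e θ) ∂surfaceMeasure d = ∫⁻ θ, F θ ∂surfaceMeasure d :=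
  (measurePreserving_sphereMap e).lintegral_comp hF

@[fun_prop]
lemma continuous_inner_sphere {d : ℕ} (v : EucSpace d) :
    Continuous fun θ : UnitSphere d => inner ℝ (θ : EucSpace d) v := by fun_prop

lemma lintegral_enorm_inner_eq_of_norm_eq {d : ℕ} {v w : EucSpace d} (h : ‖v‖ = ‖w‖) :
    ∫⁻ θ : UnitSphere d, ‖inner ℝ (θ : EucSpace d) v‖ₑ ∂surfaceMeasure d =
      ∫⁻ θ : UnitSphere d, ‖inner ℝ (θ : EucSpace d) w‖ₑ ∂surfaceMeasure d := by
  -- The reflection in the hyperplane orthogonal to `v - w` exchanges the two vectors of equal norm.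
  set R := Submodule.reflection (ℝ ∙ (v - w))ᗮ
  have hR : R v = w := Submodule.reflection_sub h
  rw [← lintegral_sphereMap R (continuous_inner_sphere w).measurable.enorm]
  refine lintegral_congr fun θ => ?_
  rw [← hR]
  simp only [sphereMap, LinearIsometryEquiv.inner_map_map]

/-- The mean over the sphere of the length of the projection of `v` to a line. -/
lemma lintegral_enorm_inner {d : ℕ} [NeZero d] (v : EucSpace d) :
    ∫⁻ θ : UnitSphere d, ‖inner ℝ (θ : EucSpace d) v‖ₑ ∂surfaceMeasure d =
      2 * croftonConst d * ‖v‖ₑ := by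
  have h : ‖v‖ = ‖‖v‖ • (EuclideanSpace.single (0 : Fin d) (1 : ℝ))‖ := by
    simp [norm_smul]
  rw [lintegral_enorm_inner_eq_of_norm_eq h, croftonConst,
    ENNReal.mul_div_cancel (by simp) (by simp),
    ← lintegral_mul_const _ (continuous_inner_sphere _).measurable.enorm]
  refine lintegral_congr fun θ => ?_
  rw [inner_smul_right, enorm_mul, mul_comm]
  simp

lemma croftonConst_ne_top (d : ℕ) [NeZero d] : croftonConst d ≠ ∞ := by
  refine (ENNReal.div_lt_top ?_ (by simp)).ne
  refine ((lintegral_mono (g := fun _ => 1) fun θ => ?_).trans_lt ?_).ne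
  · rw [← ofReal_norm, ← ENNReal.ofReal_one]
    refine ENNReal.ofReal_le_ofReal ?_
    refine (norm_inner_le_norm _ _).trans ?_
    simp
  · simp [measure_lt_top]

/-- If the constant vanished, almost every `θ` would be orthogonal to every basis vector, which no
unit vector is. -/
lemma croftonConst_ne_zero (d : ℕ) [NeZero d] : croftonConst d ≠ 0 := by
  intro h0
  have h : ∀ v : EucSpace d, ∀ᵐ θ : UnitSphere d ∂surfaceMeasure d,
      inner ℝ (θ : EucSpace d) v = 0 := by
    intro v
    have := lintegral_enorm_inner v
    rw [h0, mul_zero, zero_mul,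
      lintegral_eq_zero_iff (continuous_inner_sphere _).measurable.enorm] at this
    filter_upwards [this] with θ hθ
    simpa using hθ
  have h' : ∀ᵐ θ ∂surfaceMeasure d, False := by
    have := ae_all_iff.2 fun i : Fin d => h (EuclideanSpace.single i 1)
    filter_upwards [this] with θ hθ
    have h1 : (θ : EucSpace d) = 0 := by
      ext i
      simpa [EuclideanSpace.inner_single_right] using hθ i
    have h2 : ‖(θ : EucSpace d)‖ = 1 := by simp
    simp [h1] at h2
  rw [Filter.eventually_false_iff_eq_bot, ae_eq_bot] at h'
  exact Measure.toSphere_ne_zero (volume : Measure (EucSpace d)) h'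

/-! ### Measurability and size of the set of hyperplanes hitting a set -/

/-- The measure `dθ dr` on the set of pairs `(θ, r)` with `r ≥ 0`. -/
noncomputable def lineMeasure (d : ℕ) : Measure (UnitSphere d × ℝ) :=
  (surfaceMeasure d).prod (volume.restrict (Ici (0 : ℝ)))

/-- The set of all `(θ, r)` such that the hyperplane `D_{θ,r}` meets `A`. -/
def hitSet {d : ℕ} (A : Set (EucSpace d)) : Set (UnitSphere d × ℝ) :=
  {p | (A ∩ hyperplane p.1 p.2).Nonempty}

section HitSet

variable {d : ℕ}

lemma hitSet_mono {A B : Set (EucSpace d)} (h : A ⊆ B) : hitSet A ⊆ hitSet B :=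
  fun _ hp => Set.Nonempty.mono (inter_subset_inter_left _ h) hp

lemma hitSet_iUnion {ι : Sort*} (A : ι → Set (EucSpace d)) :
    hitSet (⋃ i, A i) = ⋃ i, hitSet (A i) := by
  ext p
  simp [hitSet, iUnion_inter]

lemma hitSet_union (A B : Set (EucSpace d)) : hitSet (A ∪ B) = hitSet A ∪ hitSet B := by
  ext p
  simp [hitSet, union_inter_distrib_right]

lemma isCompact_hitSet {A : Set (EucSpace d)} (hA : IsCompact A) : IsCompact (hitSet A) := by
  have : hitSet A = (fun p : UnitSphere d × EucSpace d =>
      (p.1, inner ℝ (p.1 : EucSpace d) p.2)) '' (univ ×ˢ A) := by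
    ext ⟨θ, r⟩
    simp only [hitSet, hyperplane, mem_ofPred_eq, mem_image, mem_prod, mem_univ, true_and,
      Prod.exists, Prod.mk.injEq]
    constructor
    · rintro ⟨y, hy, h⟩
      exact ⟨θ, y, hy, rfl, h⟩
    · rintro ⟨_, y, hy, rfl, h⟩
      exact ⟨y, hy, h⟩
  rw [this]
  exact (isCompact_univ.prod hA).image (by fun_prop)

lemma mk_preimage_hitSet (A : Set (EucSpace d)) (θ : UnitSphere d) :
    Prod.mk θ ⁻¹' hitSet A = (fun y => inner ℝ (θ : EucSpace d) y) '' A := by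
  ext r
  rfl

lemma volume_image_inner_le (A : Set (EucSpace d)) (θ : UnitSphere d) :
    volume ((fun y => inner ℝ (θ : EucSpace d) y) '' A) ≤ Measure.hausdorffMeasure 1 A := by
  have h : LipschitzWith 1 (fun y => inner ℝ (θ : EucSpace d) y) := by
    refine LipschitzWith.of_dist_le_mul fun x y => ?_
    rw [Real.dist_eq, ← inner_sub_right, dist_eq_norm]
    refine (abs_real_inner_le_norm _ _).trans ?_
    simp
  rw [← hausdorffMeasure_real]
  simpa using h.hausdorffMeasure_image_le zero_le_one A

lemma lineMeasure_hitSet_le_of_measurableSet {A : Set (EucSpace d)}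
    (hA : MeasurableSet (hitSet A)) :
    lineMeasure d (hitSet A) ≤ surfaceMeasure d univ * Measure.hausdorffMeasure 1 A := by
  rw [lineMeasure, Measure.prod_apply hA]
  calc _ ≤ ∫⁻ _ : UnitSphere d, Measure.hausdorffMeasure 1 A ∂surfaceMeasure d := by
        refine lintegral_mono fun θ => (Measure.restrict_apply_le _ _).trans ?_
        rw [mk_preimage_hitSet]
        exact volume_image_inner_le A θ
    _ = _ := by rw [lintegral_const, mul_comm]

/-- Fubini needs a measurable hit set, which `N` need not provide. So `N` is enlarged to a
relatively open subset of `K` of small Hausdorff measure; that set is a countable union of compacts,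
and so is its hit set. -/
lemma lineMeasure_hitSet_eq_zero {K N : Set (EucSpace d)} (hK : IsCompact K)
    (hK' : Measure.hausdorffMeasure 1 K ≠ ∞) (hN : N ⊆ K)
    (hN' : Measure.hausdorffMeasure 1 N = 0) : lineMeasure d (hitSet N) = 0 := by
  set μ : Measure (EucSpace d) := (Measure.hausdorffMeasure 1).restrict K
  have : IsFiniteMeasure μ := ⟨by simpa [μ] using hK'.lt_top⟩
  by_contra h
  obtain ⟨ε, hε, hlt⟩ := ENNReal.exists_nnreal_pos_mul_lt
    (measure_ne_top (surfaceMeasure d) univ) h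
  have hμN : μ N < ε := by
    rw [le_antisymm ((Measure.restrict_apply_le _ _).trans hN'.le) bot_le]
    simpa using hε
  obtain ⟨U, hNU, hU, hUε⟩ := N.exists_isOpen_lt_of_lt _ hμN
  obtain ⟨F, hF, -, hFU, -⟩ := hU.exists_iUnion_isClosed
  have hmeas : MeasurableSet (hitSet (U ∩ K)) := by
    rw [← hFU, iUnion_inter, hitSet_iUnion]
    exact .iUnion fun n => (isCompact_hitSet (hK.inter_left (hF n))).measurableSet
  have h1 := measure_mono (μ := lineMeasure d) (hitSet_mono (subset_inter hNU hN))
  have h2 := lineMeasure_hitSet_le_of_measurableSet hmeas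
  rw [Measure.restrict_apply hU.measurableSet] at hUε
  refine (h1.trans (h2.trans ?_)).not_gt hlt
  rw [mul_comm]
  gcongr

/-- Inner regularity exhausts `A` by countably many compacts up to a null set. The compacts have
compact hit sets, and the remainder has a null one. -/
lemma nullMeasurableSet_hitSet_and_le {K A : Set (EucSpace d)} (hK : IsCompact K)
    (hK' : Measure.hausdorffMeasure 1 K ≠ ∞) (hA : MeasurableSet A) (hAK : A ⊆ K) :
    NullMeasurableSet (hitSet A) (lineMeasure d) ∧
      lineMeasure d (hitSet A) ≤ surfaceMeasure d univ * Measure.hausdorffMeasure 1 A := by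
  set μ : Measure (EucSpace d) := (Measure.hausdorffMeasure 1).restrict K
  have : IsFiniteMeasure μ := ⟨by simpa [μ] using hK'.lt_top⟩
  have hex : ∀ n : ℕ, ∃ C ⊆ A, IsCompact C ∧ μ (A \ C) < ((n : ℝ≥0∞) + 1)⁻¹ := fun n =>
    hA.exists_isCompact_sdiff_lt (measure_ne_top _ _) (by simp)
  choose C hCA hC hμC using hex
  have hmeas : MeasurableSet (hitSet (⋃ n, C n)) := by
    rw [hitSet_iUnion]
    exact .iUnion fun n => (isCompact_hitSet (hC n)).measurableSet
  have hCA' : ⋃ n, C n ⊆ A := iUnion_subset hCA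
  have hnull : Measure.hausdorffMeasure 1 (A \ ⋃ n, C n) = 0 := by
    have h1 : μ (A \ ⋃ n, C n) = 0 := by
      refine le_antisymm (ge_of_tendsto' ENNReal.tendsto_inv_nat_nhds_zero fun n => ?_) bot_le
      calc μ (A \ ⋃ n, C n) ≤ μ (A \ C n) :=
            measure_mono (sdiff_subset_sdiff_right (subset_iUnion C n))
        _ ≤ ((n : ℝ≥0∞) + 1)⁻¹ := (hμC n).le
        _ ≤ (n : ℝ≥0∞)⁻¹ := ENNReal.inv_le_inv.2 le_self_add
    rwa [Measure.restrict_apply (hA.diff (.iUnion fun n => (hC n).measurableSet)),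
      inter_eq_left.2 (sdiff_subset.trans hAK)] at h1
  have hz := lineMeasure_hitSet_eq_zero hK hK' (sdiff_subset.trans hAK) hnull
  have hsplit : hitSet A = hitSet (⋃ n, C n) ∪ hitSet (A \ ⋃ n, C n) := by
    rw [← hitSet_union, union_sdiff_cancel hCA']
  rw [hsplit]
  refine ⟨hmeas.nullMeasurableSet.union (.of_null hz), (measure_union_le _ _).trans ?_⟩
  rw [hz, add_zero]
  refine (lineMeasure_hitSet_le_of_measurableSet hmeas).trans ?_
  gcongr

end HitSet

/-! ### Counting intersection points through fine partitions -/

section Count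

lemma toENNReal_le_of_forall_natCast_le {m : ℕ∞} {x : ℝ≥0∞}
    (h : ∀ k : ℕ, (k : ℕ∞) ≤ m → (k : ℝ≥0∞) ≤ x) : (m : ℝ≥0∞) ≤ x := by
  induction m with
  | top =>
    by_contra! hx
    obtain ⟨k, hk⟩ := ENNReal.exists_nat_gt (hx.trans_le le_top).ne
    exact (h k le_top).not_gt hk
  | coe k => simpa using h k le_rfl

lemma tsum_indicator_one_eq_encard {α ι : Type*} (S : ι → Set α) (p : α) :
    ∑' i, (S i).indicator (1 : α → ℝ≥0∞) p = ({i | p ∈ S i}.encard : ℝ≥0∞) := by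
  rw [← ENNReal.tsum_set_one, tsum_subtype {i | p ∈ S i} fun _ => (1 : ℝ≥0∞)]
  refine tsum_congr fun i => ?_
  by_cases h : p ∈ S i <;> simp [h]

/-- The number of members of a cover which a set meets is eventually at least the number of
elements of the set, if the mesh of the cover tends to zero. -/
lemma encard_le_liminf_encard_cover {X ι : Type*} [MetricSpace X] {T : Set X}
    {B : ℕ → ι → Set X} {ε : ℕ → ℝ} (hε : Tendsto ε atTop (𝓝 0))
    (hT : ∀ n, T ⊆ ⋃ i, B n i) (hB : ∀ n i, ∀ x ∈ B n i, ∀ y ∈ B n i, dist x y ≤ ε n) :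
    (T.encard : ℝ≥0∞) ≤ liminf (fun n => ({i | (T ∩ B n i).Nonempty}.encard : ℝ≥0∞)) atTop := by
  refine toENNReal_le_of_forall_natCast_le fun k hk => ?_
  obtain ⟨F, hFT, hF⟩ := exists_subset_encard_eq hk
  have hfin : F.Finite := finite_of_encard_eq_coe hF
  have hev : ∀ᶠ n in atTop, ∀ x ∈ F, ∀ y ∈ F, x ≠ y → ε n < dist x y := by
    refine (eventually_all_finite hfin).2 fun x _ => (eventually_all_finite hfin).2 fun y _ => ?_
    by_cases h : x = y
    · simp [h]
    · filter_upwards [hε.eventually_lt_const (dist_pos.2 h)] with n hn _ using hn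
  refine le_liminf_of_le (by isBoundedDefault) ?_
  filter_upwards [hev] with n hn
  have hex : ∀ x : F, ∃ i, (x : X) ∈ B n i := fun x => mem_iUnion.1 (hT n (hFT x.2))
  choose φ hφ using hex
  -- Once the mesh is below all mutual distances in `F`, distinct points lie in distinct members.
  have hle : F.encard ≤ {i | (T ∩ B n i).Nonempty}.encard := by
    refine Function.Embedding.encard_le
      ⟨fun x => ⟨φ x, x, hFT x.2, hφ x⟩, fun x y hxy => ?_⟩
    have hxy : φ x = φ y := congrArg Subtype.val hxy
    by_contra hne
    exact (hB n _ x (hφ x) y (hxy ▸ hφ y)).not_gt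
      (hn x x.2 y y.2 fun h => hne (Subtype.ext h))
  rw [hF] at hle
  simpa using ENat.toENNReal_le.2 hle

lemma encard_cover_le_encard {X ι : Type*} {T : Set X} {B : ι → Set X}
    (hB : Pairwise (Function.onFun Disjoint B)) :
    {i | (T ∩ B i).Nonempty}.encard ≤ T.encard := by
  have hex : ∀ i : {i | (T ∩ B i).Nonempty}, (T ∩ B i).Nonempty := fun i => i.2
  choose φ hφ using hex
  refine Function.Embedding.encard_le ⟨fun i => ⟨φ i, (hφ i).1⟩, fun i j hij => ?_⟩
  have hij : φ i = φ j := congrArg Subtype.val hij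
  by_contra hne
  exact disjoint_left.1 (hB fun h => hne (Subtype.ext h)) (hφ i).2 (hij ▸ (hφ j).2)

/-- A sequence of countable measurable partitions with mesh tending to zero. -/
lemma exists_partition_dist_le (X : Type*) [MetricSpace X] [SecondCountableTopology X]
    [Nonempty X] [MeasurableSpace X] [BorelSpace X] :
    ∃ Q : ℕ → ℕ → Set X, (∀ n i, MeasurableSet (Q n i)) ∧ (∀ n, ⋃ i, Q n i = univ) ∧
      (∀ n, Pairwise (Function.onFun Disjoint (Q n))) ∧
      ∀ n i, ∀ x ∈ Q n i, ∀ y ∈ Q n i, dist x y ≤ 2 * (1 / ((n : ℝ) + 1)) := by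
  let b : ℕ → ℕ → Set X := fun n i =>
    Metric.ball (TopologicalSpace.denseSeq X i) (1 / ((n : ℝ) + 1))
  refine ⟨fun n => disjointed (b n),
    fun n i => .disjointed (fun _ => Metric.isOpen_ball.measurableSet) i,
    fun n => ?_, fun n => disjoint_disjointed _, fun n i x hx y hy => ?_⟩
  · rw [iUnion_disjointed, eq_univ_iff_forall]
    intro x
    obtain ⟨i, hi⟩ := (TopologicalSpace.denseRange_denseSeq X).exists_dist_lt x
      (Nat.one_div_pos_of_nat (α := ℝ) (n := n))
    exact mem_iUnion.2 ⟨i, hi⟩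
  · have hx' := Metric.mem_ball.1 (disjointed_subset (b n) i hx)
    have hy' := Metric.mem_ball.1 (disjointed_subset (b n) i hy)
    have := dist_triangle_right x y (TopologicalSpace.denseSeq X i)
    linarith

variable {d : ℕ}

lemma encard_hitSet_inter {ι : Type*} (A : Set (EucSpace d)) (B : ι → Set (EucSpace d))
    (p : UnitSphere d × ℝ) :
    ∑' i, (hitSet (A ∩ B i)).indicator (1 : UnitSphere d × ℝ → ℝ≥0∞) p =
      ({i | ((A ∩ hyperplane p.1 p.2) ∩ B i).Nonempty}.encard : ℝ≥0∞) := by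
  rw [tsum_indicator_one_eq_encard]
  simp only [hitSet, mem_ofPred_eq, inter_right_comm]

/-- Upper bound of the integral of the number of intersections by the measures of the sets of
hyperplanes which meet the members of a cover. -/
lemma lintegral_hyperplaneCount_le {ι : Type*} [Countable ι] {A : Set (EucSpace d)}
    {B : ℕ → ι → Set (EucSpace d)} {ε : ℕ → ℝ} (hε : Tendsto ε atTop (𝓝 0))
    (hA : ∀ n, A ⊆ ⋃ i, B n i) (hB : ∀ n i, ∀ x ∈ B n i, ∀ y ∈ B n i, dist x y ≤ ε n)
    (hm : ∀ n i, NullMeasurableSet (hitSet (A ∩ B n i)) (lineMeasure d)) :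
    ∫⁻ p, hyperplaneCount A p.1 p.2 ∂lineMeasure d ≤
      liminf (fun n => ∑' i, lineMeasure d (hitSet (A ∩ B n i))) atTop := by
  have hm' : ∀ n i, AEMeasurable ((hitSet (A ∩ B n i)).indicator
      (1 : UnitSphere d × ℝ → ℝ≥0∞)) (lineMeasure d) :=
    fun n i => aemeasurable_const.indicator₀ (hm n i)
  calc _ ≤ ∫⁻ p, liminf (fun n => ∑' i, (hitSet (A ∩ B n i)).indicator
          (1 : UnitSphere d × ℝ → ℝ≥0∞) p) atTop ∂lineMeasure d := by
        refine lintegral_mono fun p => ?_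
        simp_rw [encard_hitSet_inter]
        exact encard_le_liminf_encard_cover hε
          (fun n => inter_subset_left.trans (hA n)) hB
    _ ≤ liminf (fun n => ∫⁻ p, ∑' i, (hitSet (A ∩ B n i)).indicator
          (1 : UnitSphere d × ℝ → ℝ≥0∞) p ∂lineMeasure d) atTop :=
        lintegral_liminf_le' fun n => AEMeasurable.tsum (hm' n)
    _ = _ := by
        congr 1
        ext n
        rw [lintegral_tsum (hm' n)]
        exact tsum_congr fun i => lintegral_indicator_one₀ (hm n i)

lemma aemeasurable_hyperplaneCount_and_le {K A : Set (EucSpace d)} (hK : IsCompact K)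
    (hK' : Measure.hausdorffMeasure 1 K ≠ ∞) (hA : MeasurableSet A) (hAK : A ⊆ K) :
    AEMeasurable (fun p : UnitSphere d × ℝ => hyperplaneCount A p.1 p.2) (lineMeasure d) ∧
      ∫⁻ p, hyperplaneCount A p.1 p.2 ∂lineMeasure d ≤
        surfaceMeasure d univ * Measure.hausdorffMeasure 1 A := by
  obtain ⟨Q, hQm, hQu, hQd, hQ⟩ := exists_partition_dist_le (EucSpace d)
  have hε : Tendsto (fun n : ℕ => 2 * (1 / ((n : ℝ) + 1))) atTop (𝓝 0) := by
    simpa using tendsto_one_div_add_atTop_nhds_zero_nat.const_mul (2 : ℝ)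
  have hcov : ∀ n, A ⊆ ⋃ i, Q n i := fun n => by simp [hQu n]
  have hm : ∀ n i, NullMeasurableSet (hitSet (A ∩ Q n i)) (lineMeasure d) ∧
      lineMeasure d (hitSet (A ∩ Q n i)) ≤
        surfaceMeasure d univ * Measure.hausdorffMeasure 1 (A ∩ Q n i) := fun n i =>
    nullMeasurableSet_hitSet_and_le hK hK' (hA.inter (hQm n i)) (inter_subset_left.trans hAK)
  constructor
  -- The partitions need not refine one another: each number of pieces hit is at most the count by
  -- disjointness, and the liminf is at least the count, so the supremum is the count.
  · have heq : (fun p : UnitSphere d × ℝ => hyperplaneCount A p.1 p.2) = fun p => ⨆ n : ℕ,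
        ∑' i, (hitSet (A ∩ Q n i)).indicator (1 : UnitSphere d × ℝ → ℝ≥0∞) p := by
      ext p
      simp_rw [encard_hitSet_inter]
      refine le_antisymm ?_ (iSup_le fun n => ENat.toENNReal_le.2 (encard_cover_le_encard (hQd n)))
      refine (encard_le_liminf_encard_cover hε
        (fun n => inter_subset_left.trans (hcov n)) hQ).trans ?_
      exact (liminf_le_limsup).trans limsup_le_iSup
    rw [heq]
    exact AEMeasurable.iSup fun n => AEMeasurable.tsum fun i =>
      aemeasurable_const.indicator₀ (hm n i).1
  · refine (lintegral_hyperplaneCount_le hε hcov hQ fun n i => (hm n i).1).trans ?_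
    refine (liminf_le_liminf (v := fun _ => surfaceMeasure d univ * Measure.hausdorffMeasure 1 A)
      (Eventually.of_forall fun n => ?_)).trans (by rw [liminf_const])
    refine (ENNReal.tsum_le_tsum fun i => (hm n i).2).trans ?_
    rw [ENNReal.tsum_mul_left, ← measure_iUnion
      (fun i j h => (hQd n h).mono inter_subset_right inter_subset_right)
      (fun i => hA.inter (hQm n i)), ← inter_iUnion, hQu n, inter_univ]

end Count

/-! ### The Crofton measure and its lower bound on connected sets -/

section Crofton

variable {d : ℕ}

lemma croftonIntegral_eq_lintegral_lineMeasure [NeZero d] {A : Set (EucSpace d)}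
    (hA : AEMeasurable (fun p : UnitSphere d × ℝ => hyperplaneCount A p.1 p.2) (lineMeasure d)) :
    croftonIntegral A =
      (croftonConst d)⁻¹ * ∫⁻ p, hyperplaneCount A p.1 p.2 ∂lineMeasure d := by
  rw [croftonIntegral, lineMeasure, lintegral_prod _ hA]

lemma hyperplaneCount_iUnion {A : ℕ → Set (EucSpace d)}
    (hA : Pairwise (Function.onFun Disjoint A)) (θ : UnitSphere d) (r : ℝ) :
    hyperplaneCount (⋃ i, A i) θ r = ∑' i, hyperplaneCount (A i) θ r := by
  -- With every set measurable, the counting measure equals the cardinality on arbitrary sets.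
  let _ : MeasurableSpace (EucSpace d) := ⊤
  have h := measure_iUnion (μ := @Measure.count (EucSpace d) ⊤)
    (f := fun i => A i ∩ hyperplane θ r)
    (fun i j h => (hA h).mono inter_subset_left inter_subset_left) (fun _ => trivial)
  rw [← iUnion_inter] at h
  simpa only [Measure.count_apply MeasurableSpace.measurableSet_top, hyperplaneCount] using h

lemma exists_croftonMeasure [NeZero d] {K : Set (EucSpace d)} (hK : IsCompact K)
    (hK' : Measure.hausdorffMeasure 1 K ≠ ∞) :
    ∃ γ : Measure (EucSpace d), ∀ A, MeasurableSet A →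
      γ A = (croftonConst d)⁻¹ * ∫⁻ p, hyperplaneCount (A ∩ K) p.1 p.2 ∂lineMeasure d := by
  refine ⟨Measure.ofMeasurable (fun A _ => (croftonConst d)⁻¹ *
    ∫⁻ p, hyperplaneCount (A ∩ K) p.1 p.2 ∂lineMeasure d) ?_ ?_, fun A hA => ?_⟩
  · simp [hyperplaneCount]
  · intro A hA hd
    simp_rw [iUnion_inter]
    rw [ENNReal.tsum_mul_left, ← lintegral_tsum fun i =>
      (aemeasurable_hyperplaneCount_and_le hK hK' ((hA i).inter hK.measurableSet)
        inter_subset_right).1]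
    congr 1
    refine lintegral_congr fun p => hyperplaneCount_iUnion ?_ _ _
    exact fun i j h => (hd h).mono inter_subset_left inter_subset_left
  · exact Measure.ofMeasurable_apply A hA

/-- The half line `r ≥ 0` sees one half of the hyperplanes which meet a compact set. -/
lemma two_mul_lineMeasure_hitSet {C : Set (EucSpace d)} (hC : IsCompact C) :
    2 * lineMeasure d (hitSet C) =
      ∫⁻ θ : UnitSphere d, volume ((fun y => inner ℝ (θ : EucSpace d) y) '' C)
        ∂surfaceMeasure d := by
  have hm := (isCompact_hitSet hC).measurableSet
  set G : UnitSphere d → ℝ≥0∞ :=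
    fun θ => (volume.restrict (Ici (0 : ℝ))) (Prod.mk θ ⁻¹' hitSet C)
  have hG : Measurable G := measurable_measure_prodMk_left hm
  have h1 : lineMeasure d (hitSet C) = ∫⁻ θ, G θ ∂surfaceMeasure d := by
    rw [lineMeasure, Measure.prod_apply hm]
  set e := LinearIsometryEquiv.neg ℝ (E := EucSpace d)
  rw [two_mul]
  nth_rewrite 2 [h1]
  rw [← lintegral_sphereMap e hG, h1, ← lintegral_add_left hG]
  refine lintegral_congr fun θ => ?_
  have hP : MeasurableSet ((fun y => inner ℝ (θ : EucSpace d) y) '' C) :=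
    (hC.image (by fun_prop)).measurableSet
  -- The antipode `-θ` with `r ≥ 0` sees the part `r ≤ 0` of the projection along `θ`; the overlap
  -- at `r = 0` is null.
  have hneg : Prod.mk (sphereMap e θ) ⁻¹' hitSet C ∩ Ici (0 : ℝ) =
      -((fun y => inner ℝ (θ : EucSpace d) y) '' C ∩ Iic 0) := by
    ext r
    simp only [mk_preimage_hitSet, mem_inter_iff, mem_image, mem_Ici, Set.mem_neg, mem_Iic,
      Left.neg_nonpos_iff, and_congr_left_iff]
    intro _
    refine exists_congr fun y => and_congr_right fun _ => ?_
    simp [sphereMap, e, neg_eq_iff_eq_neg]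
  simp only [G, Measure.restrict_apply' measurableSet_Ici]
  rw [hneg, Measure.measure_neg, mk_preimage_hitSet,
    ← measure_congr (μ := volume) (Filter.EventuallyEq.rfl.inter Iio_ae_eq_Iic), add_comm,
    ← compl_Ici, ← sdiff_eq, measure_sdiff_add_inter _ measurableSet_Ici]

/-- Each projection of a connected set contains the interval between the projections of `x` and `y`;
averaging over `θ` gives the bound. -/
lemma lower_bound_lineMeasure_hitSet [NeZero d] {C : Set (EucSpace d)} (hC : IsCompact C)
    (hC' : IsPreconnected C) {x y : EucSpace d} (hx : x ∈ C) (hy : y ∈ C) :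
    croftonConst d * edist x y ≤ lineMeasure d (hitSet C) := by
  have h2 : 2 * (croftonConst d * edist x y) ≤ 2 * lineMeasure d (hitSet C) := by
    rw [two_mul_lineMeasure_hitSet hC, ← mul_assoc, edist_eq_enorm_sub, ← lintegral_enorm_inner]
    refine lintegral_mono fun θ => ?_
    have hI : uIcc (inner ℝ (θ : EucSpace d) y) (inner ℝ (θ : EucSpace d) x) ⊆
        (fun y => inner ℝ (θ : EucSpace d) y) '' C :=
      (hC'.image _ (by fun_prop)).ordConnected.uIcc_subset
        (mem_image_of_mem _ hy) (mem_image_of_mem _ hx)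
    refine le_trans (le_of_eq ?_) (measure_mono hI)
    rw [Real.volume_interval, ← inner_sub_right, ← Real.norm_eq_abs, ofReal_norm]
  exact (ENNReal.mul_le_mul_iff_right (by simp) (by simp)).1 h2

end Crofton

/-! ### Parametrization by arc length -/

section ArcLength

/-- `g` is a parametrization of the curve `f` by its arc length `ℓ`, of total length `L`. -/
structure IsArcLengthParam {d : ℕ} (f : C(unitInterval, EucSpace d)) (L : ℝ)
    (g : ℝ → EucSpace d) (ℓ : unitInterval → ℝ) : Prop where
  lipschitz : LipschitzWith 1 g
  monotone : Monotone ℓ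
  apply_eq : ∀ t, g (ℓ t) = f t
  range_eq : range ℓ = Icc 0 L
  variation_eq : ∀ s t, s ≤ t → eVariationOn f (Icc s t) = ENNReal.ofReal (ℓ t - ℓ s)

/-- The one-sided jumps of the variation function are those of `f`, hence zero. -/
lemma continuous_variationOnFromTo {E : Type*} [PseudoMetricSpace E] {f : unitInterval → E}
    (hf : Continuous f) (hv : BoundedVariationOn f univ) (a : unitInterval) :
    Continuous (variationOnFromTo f univ a) := by
  refine continuous_iff_continuousAt.2 fun b => ?_
  have hl := variationOnFromTo.tendsto_left (mem_univ a) (mem_univ b) hv.locallyBoundedVariationOn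
    (hf.continuousAt.mono_left inf_le_left : Tendsto f (𝓝[univ ∩ Iio b] b) (𝓝 (f b)))
  have hr := variationOnFromTo.tendsto_right (mem_univ a) (mem_univ b) hv.locallyBoundedVariationOn
    (hf.continuousAt.mono_left inf_le_left : Tendsto f (𝓝[univ ∩ Ioi b] b) (𝓝 (f b)))
  rw [univ_inter, dist_self, sub_zero] at hl
  rw [univ_inter, dist_self, add_zero] at hr
  exact continuousAt_iff_continuous_left'_right'.2 ⟨hl, hr⟩

lemma exists_isArcLengthParam {d : ℕ} (f : C(unitInterval, EucSpace d)) (hf : IsRectifiable f) :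
    ∃ L g ℓ, 0 ≤ L ∧ ENNReal.ofReal L = curveLength f ∧ IsArcLengthParam f L g ℓ := by
  have hv : BoundedVariationOn f univ := hf.ne
  have hlv := hv.locallyBoundedVariationOn
  set ℓ : unitInterval → ℝ := variationOnFromTo f univ 0
  have hmono : Monotone ℓ := monotoneOn_univ.1 (variationOnFromTo.monotoneOn hlv (mem_univ 0))
  have hvar : ∀ s t, s ≤ t → eVariationOn f (Icc s t) = ENNReal.ofReal (ℓ t - ℓ s) := by
    intro s t hst
    rw [variationOnFromTo.sub_right hlv (mem_univ _) (mem_univ _) (mem_univ _),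
      variationOnFromTo.eq_of_le _ _ hst, univ_inter,
      ENNReal.ofReal_toReal (hv.mono (subset_univ _))]
  have h0 : ℓ 0 = 0 := variationOnFromTo.self _ _ _
  have hcont : Continuous ℓ := continuous_variationOnFromTo f.continuous hv 0
  have hL : 0 ≤ ℓ 1 := h0 ▸ hmono zero_le_one
  have hIcc : Icc (0 : unitInterval) 1 = univ := by
    ext t
    simp [unitInterval.le_one']
  have hrange : range ℓ = Icc 0 (ℓ 1) := by
    rw [← image_univ, ← hIcc]
    refine Subset.antisymm ?_ ?_
    · rintro _ ⟨t, ht, rfl⟩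
      exact ⟨h0 ▸ hmono ht.1, hmono ht.2⟩
    · have := intermediate_value_Icc (zero_le_one (α := unitInterval)) hcont.continuousOn
      rwa [h0] at this
  have hdist : ∀ s t, dist (f s) (f t) ≤ dist (ℓ s) (ℓ t) := by
    intro s t
    wlog hst : s ≤ t generalizing s t
    · rw [dist_comm, dist_comm (ℓ s)]
      exact this t s (le_of_not_ge hst)
    have h1 := eVariationOn.edist_le f (left_mem_Icc.2 hst) (right_mem_Icc.2 hst)
    rw [hvar s t hst, edist_dist] at h1
    have h2 := (ENNReal.ofReal_le_ofReal_iff (sub_nonneg.2 (hmono hst))).1 h1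
    rw [dist_comm (ℓ s), Real.dist_eq]
    exact h2.trans (le_abs_self _)
  have hex : ∀ x : Icc 0 (ℓ 1), ∃ t, ℓ t = x := fun x => hrange.ge x.2
  choose τ hτ using hex
  -- Any section `τ` of `ℓ` will do: by `hdist`, `f` is constant on the fibres of `ℓ`. The
  -- projection extends the curve to the whole line as a 1-Lipschitz map.
  refine ⟨ℓ 1, fun x => f (τ (projIcc 0 (ℓ 1) hL x)), ℓ, hL, ?_, ?_, hmono, ?_, hrange, hvar⟩
  · rw [curveLength, ← hIcc, hvar 0 1 zero_le_one, h0, sub_zero]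
  · refine LipschitzWith.of_dist_le_mul fun x y => (hdist _ _).trans ?_
    rw [hτ, hτ]
    exact (LipschitzWith.projIcc hL).dist_le_mul x y
  · intro t
    have ht : ℓ t ∈ Icc 0 (ℓ 1) := hrange ▸ mem_range_self t
    refine dist_le_zero.1 ((hdist _ _).trans ?_)
    rw [hτ, projIcc_of_mem hL ht, dist_self]

namespace IsArcLengthParam

variable {d : ℕ} {f : C(unitInterval, EucSpace d)} {L : ℝ} {g : ℝ → EucSpace d}
  {ℓ : unitInterval → ℝ}

lemma image_Icc_subset (h : IsArcLengthParam f L g ℓ) (s t : unitInterval) :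
    f '' Icc s t ⊆ g '' Icc (ℓ s) (ℓ t) := by
  rintro _ ⟨u, hu, rfl⟩
  exact ⟨ℓ u, ⟨h.monotone hu.1, h.monotone hu.2⟩, h.apply_eq u⟩

lemma image_eq_range (h : IsArcLengthParam f L g ℓ) : g '' Icc 0 L = range f := by
  rw [← h.range_eq, ← range_comp]
  congr 1
  ext1 t
  exact h.apply_eq t

lemma hausdorffMeasure_image_le (h : IsArcLengthParam f L g ℓ) (S : Set ℝ) :
    Measure.hausdorffMeasure 1 (g '' S) ≤ volume S := by
  rw [← hausdorffMeasure_real]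
  simpa using h.lipschitz.hausdorffMeasure_image_le zero_le_one S

lemma hausdorffMeasure_image_Icc_le (h : IsArcLengthParam f L g ℓ) {s t : unitInterval}
    (hst : s ≤ t) : Measure.hausdorffMeasure 1 (f '' Icc s t) ≤ eVariationOn f (Icc s t) := by
  rw [h.variation_eq s t hst, ← Real.volume_Icc]
  exact (measure_mono (h.image_Icc_subset s t)).trans (h.hausdorffMeasure_image_le _)

lemma hausdorffMeasure_range_le (h : IsArcLengthParam f L g ℓ) :
    Measure.hausdorffMeasure 1 (range f) ≤ ENNReal.ofReal L := by
  rw [← h.image_eq_range]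
  simpa using h.hausdorffMeasure_image_le (Icc 0 L)

/-- Transfers almost-everywhere statements from the parameter to the image; only an inequality,
since the pushforward counts multiplicity. -/
lemma restrict_hausdorffMeasure_le_map (h : IsArcLengthParam f L g ℓ) (S : Set ℝ) :
    (Measure.hausdorffMeasure 1).restrict (g '' S) ≤ (volume.restrict S).map g := by
  refine Measure.le_iff.2 fun B hB => ?_
  have hg := h.lipschitz.continuous.measurable
  rw [Measure.restrict_apply hB, Measure.map_apply hg hB, Measure.restrict_apply (hg hB),
    inter_comm, ← image_inter_preimage, inter_comm]
  exact h.hausdorffMeasure_image_le _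

end IsArcLengthParam

end ArcLength

/-! ### Domination of the Hausdorff measure -/

section Domination

lemma ae_one_le_of_forall_sub_le_integral {φ : ℝ → ℝ} (hφ : LocallyIntegrable φ) {L : ℝ}
    (h : ∀ a ∈ Icc 0 L, ∀ b ∈ Icc 0 L, a ≤ b → b - a ≤ ∫ x in a..b, φ x) :
    ∀ᵐ x ∂volume.restrict (Icc 0 L), 1 ≤ φ x := by
  rw [← restrict_Ioo_eq_restrict_Icc, ae_restrict_iff' measurableSet_Ioo]
  filter_upwards [LocallyIntegrable.ae_hasDerivAt_integral hφ] with x hx hxL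
  have hd := (hasDerivWithinAt_iff_tendsto_slope' self_notMem_Ioi).1
    ((hx 0).hasDerivWithinAt (s := Ioi x))
  refine ge_of_tendsto hd ?_
  filter_upwards [Ioo_mem_nhdsGT hxL.2] with y hy
  have hi : ∀ a b, IntervalIntegrable φ volume a b := fun a b =>
    intervalIntegrable_iff.2 ((hφ.integrableOn_isCompact isCompact_uIcc).mono_set uIoc_subset_uIcc)
  have hxy := h x ⟨hxL.1.le, hxL.2.le⟩ y ⟨(hxL.1.trans hy.1).le, hy.2.le⟩ hy.1.le
  rw [slope_def_field, intervalIntegral.integral_interval_sub_left (hi _ _) (hi _ _),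
    le_div_iff₀ (sub_pos.2 hy.1), one_mul]
  exact hxy

lemma exists_density_le {X : Type*} [MeasurableSpace X] {μ ν : Measure X} [IsFiniteMeasure μ]
    {C : ℝ≥0} (h : ν ≤ C • μ) :
    ∃ ρ : X → ℝ, Measurable ρ ∧ (∀ x, 0 ≤ ρ x ∧ ρ x ≤ C) ∧
      ν = μ.withDensity fun x => ENNReal.ofReal (ρ x) := by
  have hfin : IsFiniteMeasure ν := isFiniteMeasure_of_le _ h
  have hac : ν ≪ μ := Measure.absolutelyContinuous_of_le_smul (c := C) h
  have hden := Measure.withDensity_rnDeriv_eq ν μ hac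
  have hle : ν.rnDeriv μ ≤ᵐ[μ] fun _ => (C : ℝ≥0∞) := by
    refine ae_le_of_forall_setLIntegral_le_of_sigmaFinite (ν.measurable_rnDeriv μ) fun s _ _ => ?_
    refine (Measure.setLIntegral_rnDeriv_le s).trans ((h s).trans ?_)
    simp
  refine ⟨fun x => (min (ν.rnDeriv μ x) C).toReal,
    ((ν.measurable_rnDeriv μ).min measurable_const).ennreal_toReal,
    fun x => ⟨ENNReal.toReal_nonneg, ?_⟩, ?_⟩
  · exact ENNReal.toReal_mono (by simp) (min_le_right _ _)
  -- Truncating the Radon–Nikodym derivative at `C` changes it only on a null set and makes the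
  -- bound hold everywhere.
  · nth_rewrite 1 [← hden]
    refine withDensity_congr_ae ?_
    filter_upwards [hle] with x hx
    rw [ENNReal.ofReal_toReal (ne_top_of_le_ne_top (by simp) (min_le_right _ _)), min_eq_left hx]

/-- A measure on the image of a curve which is bounded by a multiple of the Hausdorff measure, and
which gives to each arc at least the distance of its end points, dominates the Hausdorff measure. -/
lemma IsArcLengthParam.restrict_hausdorffMeasure_le {d : ℕ} {f : C(unitInterval, EucSpace d)}
    {L : ℝ} {g : ℝ → EucSpace d} {ℓ : unitInterval → ℝ} (h : IsArcLengthParam f L g ℓ)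
    {ν : Measure (EucSpace d)} {C : ℝ≥0}
    (hC : ν ≤ C • (Measure.hausdorffMeasure 1).restrict (range f))
    (hν : ∀ s t, s ≤ t → edist (f s) (f t) ≤ ν (f '' Icc s t)) :
    (Measure.hausdorffMeasure 1).restrict (range f) ≤ ν := by
  set μ : Measure (EucSpace d) := (Measure.hausdorffMeasure 1).restrict (range f) with hμ
  have : IsFiniteMeasure μ := ⟨by
    rw [hμ, Measure.restrict_apply_univ]
    exact h.hausdorffMeasure_range_le.trans_lt ENNReal.ofReal_lt_top⟩
  obtain ⟨ρ, hρ, hρC, rfl⟩ := exists_density_le hC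
  have hg := h.lipschitz.continuous.measurable
  have hφm : Measurable fun x => ρ (g x) := hρ.comp hg
  have hφ : LocallyIntegrable (fun x => ρ (g x)) := by
    refine (locallyIntegrable_const (C : ℝ)).mono hφm.aestronglyMeasurable (ae_of_all _ fun x => ?_)
    rw [Real.norm_of_nonneg (hρC _).1]
    exact (hρC _).2.trans (le_abs_self _)
  have harc : ∀ s t, s ≤ t →
      edist (f s) (f t) ≤ ENNReal.ofReal (∫ x in ℓ s..ℓ t, ρ (g x)) := by
    intro s t hst
    have hm : MeasurableSet (f '' Icc s t) := (isCompact_Icc.image f.continuous).measurableSet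
    calc edist (f s) (f t)
        ≤ ∫⁻ y in f '' Icc s t, ENNReal.ofReal (ρ y) ∂μ := by
          rw [← withDensity_apply _ hm]; exact hν s t hst
      _ = ∫⁻ y in f '' Icc s t, ENNReal.ofReal (ρ y) ∂Measure.hausdorffMeasure 1 := by
          rw [hμ, Measure.restrict_restrict hm, inter_eq_left.2 (image_subset_range _ _)]
      _ ≤ ∫⁻ y, ENNReal.ofReal (ρ y) ∂(volume.restrict (Icc (ℓ s) (ℓ t))).map g :=
          lintegral_mono' ((Measure.restrict_mono_set _ (h.image_Icc_subset s t)).trans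
            (h.restrict_hausdorffMeasure_le_map _)) le_rfl
      _ = ∫⁻ x in Icc (ℓ s) (ℓ t), ENNReal.ofReal (ρ (g x)) :=
          lintegral_map hρ.ennreal_ofReal hg
      _ = ENNReal.ofReal (∫ x in ℓ s..ℓ t, ρ (g x)) := by
          rw [intervalIntegral.integral_of_le (h.monotone hst), ← integral_Icc_eq_integral_Ioc,
            ofReal_integral_eq_lintegral_ofReal (hφ.integrableOn_isCompact isCompact_Icc)
              (ae_of_all _ fun x => (hρC _).1)]
  have hi : ∀ a b, IntervalIntegrable (fun x => ρ (g x)) volume a b :=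
    fun a b =>
    intervalIntegrable_iff.2 ((hφ.integrableOn_isCompact isCompact_uIcc).mono_set uIoc_subset_uIcc)
  set F : unitInterval → ℝ := fun s => ∫ x in (0 : ℝ)..ℓ s, ρ (g x) with hF
  have hFsub : ∀ s t, F t - F s = ∫ x in ℓ s..ℓ t, ρ (g x) := fun s t =>
    intervalIntegral.integral_interval_sub_left (hi _ _) (hi _ _)
  have hFmono : Monotone F := by
    intro s t hst
    rw [← sub_nonneg, hFsub]
    exact intervalIntegral.integral_nonneg (h.monotone hst) fun x _ => (hρC _).1
  -- Each chord is at most an increment of the monotone `F`, and these increments telescope over any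
  -- subdivision.
  have hvar : ∀ s t, s ≤ t → eVariationOn f (Icc s t) ≤ ENNReal.ofReal (F t - F s) := by
    intro s t hst
    calc eVariationOn f (Icc s t) ≤ eVariationOn F (Icc s t) := by
          refine iSup_mono fun p => Finset.sum_le_sum fun i _ => ?_
          have hp := p.2.2.1 (Nat.le_succ i)
          rw [edist_comm, edist_dist (F _), Real.dist_eq,
            abs_of_nonneg (sub_nonneg.2 (hFmono hp)), hFsub]
          exact harc _ _ hp
      _ ≤ _ := by
          have := (hFmono.monotoneOn univ).eVariationOn_eq (mem_univ s) (mem_univ t)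
          exact (univ_inter (Icc s t) ▸ this).le
  have hone := ae_one_le_of_forall_sub_le_integral hφ (L := L) (by
    intro a ha b hb hab
    rw [← h.range_eq] at ha hb
    obtain ⟨s, rfl⟩ := ha
    obtain ⟨t, rfl⟩ := hb
    rcases le_total s t with hst | hst
    · have := hvar s t hst
      rw [h.variation_eq s t hst, hFsub, ENNReal.ofReal_le_ofReal_iff] at this
      · exact this
      · rw [← hFsub]; exact sub_nonneg.2 (hFmono hst)
    · rw [le_antisymm hab (h.monotone hst)]
      simp)
  have hle : μ ≤ (volume.restrict (Icc 0 L)).map g := by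
    rw [hμ, ← h.image_eq_range]
    exact h.restrict_hausdorffMeasure_le_map _
  have hae : ∀ᵐ y ∂μ, 1 ≤ ENNReal.ofReal (ρ y) := by
    refine ae_mono hle ((ae_map_iff hg.aemeasurable
      (measurableSet_le measurable_const hρ.ennreal_ofReal)).2 ?_)
    filter_upwards [hone] with x hx
    simpa using hx
  calc μ = μ.withDensity 1 := withDensity_one.symm
    _ ≤ _ := withDensity_mono hae

end Domination

/-! ### The total Crofton mass is at most the length -/

section UpperBound

lemma volume_image_le_lintegral_deriv {u u' : ℝ → ℝ} {s : Set ℝ} (hs : MeasurableSet s)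
    (hu : ∀ x ∈ s, HasDerivAt u (u' x) x) : volume (u '' s) ≤ ∫⁻ x in s, ‖u' x‖ₑ := by
  have := addHaar_image_le_lintegral_abs_det_fderiv volume hs
    (f' := fun x => ContinuousLinearMap.toSpanSingleton ℝ (u' x))
    fun x hx => (hu x hx).hasFDerivAt.hasFDerivWithinAt
  refine this.trans_eq (lintegral_congr fun x => ?_)
  rw [ContinuousLinearMap.det_toSpanSingleton, ← ofReal_norm, Real.norm_eq_abs]

namespace IsArcLengthParam

variable {d : ℕ} {f : C(unitInterval, EucSpace d)} {L : ℝ} {g : ℝ → EucSpace d}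
  {ℓ : unitInterval → ℝ}

lemma volume_image_inner_le_lintegral (h : IsArcLengthParam f L g ℓ) {J : Set ℝ}
    (hJ : MeasurableSet J) (θ : UnitSphere d) :
    volume ((fun y => inner ℝ (θ : EucSpace d) y) '' (g '' J)) ≤
      ∫⁻ x in J, ‖inner ℝ (θ : EucSpace d) (deriv g x)‖ₑ := by
  set D := {x | DifferentiableAt ℝ g x}
  have hD : MeasurableSet D := measurableSet_of_differentiableAt ℝ g
  -- By Rademacher's theorem; the Lipschitz image of this null set, and its projections, are null as
  -- well.
  have hnull : volume (J \ D) = 0 :=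
    measure_mono_null (fun x hx => hx.2) (ae_iff.1 h.lipschitz.ae_differentiableAt)
  have h1 : volume ((fun y => inner ℝ (θ : EucSpace d) y) '' (g '' (J \ D))) = 0 :=
    le_antisymm ((volume_image_inner_le _ θ).trans
      ((h.hausdorffMeasure_image_le _).trans hnull.le)) bot_le
  rw [← inter_union_sdiff J D, image_union, image_union]
  refine (measure_union_le _ _).trans ?_
  rw [h1, add_zero, inter_union_sdiff, image_image]
  refine (volume_image_le_lintegral_deriv
    (u' := fun x => inner ℝ (θ : EucSpace d) (deriv g x)) (hJ.inter hD) fun x hx => ?_).trans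
    (lintegral_mono_set inter_subset_left)
  exact ((innerSL ℝ (θ : EucSpace d)).hasFDerivAt.comp_hasDerivAt x hx.2.hasDerivAt)

lemma lineMeasure_hitSet_image_le [NeZero d] (h : IsArcLengthParam f L g ℓ) {J : Set ℝ}
    (hJ : IsCompact J) : lineMeasure d (hitSet (g '' J)) ≤ croftonConst d * volume J := by
  have hmeas : Measurable fun p : UnitSphere d × ℝ =>
      ‖inner ℝ (p.1 : EucSpace d) (deriv g p.2)‖ₑ := by
    have h1 : Measurable fun p : UnitSphere d × ℝ => (p.1 : EucSpace d) :=
      measurable_subtype_coe.comp measurable_fst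
    have h2 : Measurable fun p : UnitSphere d × ℝ => deriv g p.2 :=
      (measurable_deriv g).comp measurable_snd
    exact (h1.inner h2).enorm
  have h2 : 2 * lineMeasure d (hitSet (g '' J)) ≤ 2 * (croftonConst d * volume J) := by
    rw [two_mul_lineMeasure_hitSet (hJ.image h.lipschitz.continuous)]
    calc _ ≤ ∫⁻ θ : UnitSphere d, (∫⁻ x in J, ‖inner ℝ (θ : EucSpace d) (deriv g x)‖ₑ)
            ∂surfaceMeasure d :=
          lintegral_mono fun θ => h.volume_image_inner_le_lintegral hJ.measurableSet θ
      _ = ∫⁻ x in J, ∫⁻ θ : UnitSphere d, ‖inner ℝ (θ : EucSpace d) (deriv g x)‖ₑ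
            ∂surfaceMeasure d := lintegral_lintegral_swap hmeas.aemeasurable
      _ ≤ ∫⁻ x in J, 2 * croftonConst d := by
          refine lintegral_mono fun x => ?_
          rw [lintegral_enorm_inner]
          refine mul_le_of_le_one_right' ?_
          rw [← ofReal_norm, ← ENNReal.ofReal_one]
          exact ENNReal.ofReal_le_ofReal (by simpa using norm_deriv_le_of_lipschitz h.lipschitz)
      _ = _ := by rw [setLIntegral_const, mul_assoc]
  exact (ENNReal.mul_le_mul_iff_right (by simp) (by simp)).1 h2

lemma lintegral_hyperplaneCount_range_le [NeZero d] (h : IsArcLengthParam f L g ℓ) :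
    ∫⁻ p, hyperplaneCount (range f) p.1 p.2 ∂lineMeasure d ≤
      croftonConst d * ENNReal.ofReal L := by
  let b : ℕ → ℝ := fun n => 1 / ((n : ℝ) + 1)
  have hb : ∀ n, 0 < b n := fun n => Nat.one_div_pos_of_nat
  -- Closed intervals keep the images compact. They overlap only at endpoints, so their lengths
  -- still sum to `L`.
  let J : ℕ → ℤ → Set ℝ := fun n i => Icc 0 L ∩ Icc (i • b n) ((i + 1) • b n)
  have hJ : ∀ n i, IsCompact (J n i) := fun n i => isCompact_Icc.inter_right isClosed_Icc
  have hsub : ∀ n i, g '' J n i ⊆ range f := fun n i =>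
    h.image_eq_range ▸ image_mono inter_subset_left
  have hint : ∀ n i, range f ∩ g '' J n i = g '' J n i := fun n i => inter_eq_right.2 (hsub n i)
  have hvol : ∀ n, ∑' i, volume (J n i) = ENNReal.ofReal L := by
    intro n
    have h1 : ∀ i, volume (J n i) = volume (Icc 0 L ∩ Ico (i • b n) ((i + 1) • b n)) := fun i =>
      measure_congr (Filter.EventuallyEq.rfl.inter Ico_ae_eq_Icc.symm)
    simp_rw [h1]
    rw [← measure_iUnion
      (fun i j hij => (pairwise_disjoint_Ico_zsmul (b n) hij).mono inter_subset_right
        inter_subset_right) (fun i => measurableSet_Icc.inter measurableSet_Ico),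
      ← inter_iUnion, iUnion_Ico_zsmul (hb n), inter_univ, Real.volume_Icc, sub_zero]
  refine (lintegral_hyperplaneCount_le (B := fun n i => g '' J n i) (ε := b)
    tendsto_one_div_add_atTop_nhds_zero_nat (fun n => ?_) ?_ fun n i => ?_).trans ?_
  · rw [← image_iUnion, ← inter_iUnion, iUnion_Icc_zsmul (hb n), inter_univ, h.image_eq_range]
  · rintro n i _ ⟨x, hx, rfl⟩ _ ⟨y, hy, rfl⟩
    refine (h.lipschitz.dist_le_mul x y).trans ?_
    have := Real.dist_le_of_mem_Icc hx.2 hy.2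
    simpa [add_smul] using this
  · rw [hint]
    exact (isCompact_hitSet ((hJ n i).image h.lipschitz.continuous)).measurableSet.nullMeasurableSet
  · simp_rw [hint]
    refine (liminf_le_liminf (v := fun _ => croftonConst d * ENNReal.ofReal L)
      (Eventually.of_forall fun n => ?_)).trans (by rw [liminf_const])
    refine (ENNReal.tsum_le_tsum fun i => h.lineMeasure_hitSet_image_le (hJ n i)).trans ?_
    rw [ENNReal.tsum_mul_left, hvol n]

end IsArcLengthParam

end UpperBound

/-! ### Almost every point is visited once -/

section Multiplicity

lemma lineMeasure_hitSet_le_lintegral_hyperplaneCount {d : ℕ} {C : Set (EucSpace d)}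
    (hC : IsCompact C) :
    lineMeasure d (hitSet C) ≤ ∫⁻ p, hyperplaneCount C p.1 p.2 ∂lineMeasure d := by
  rw [← lintegral_indicator_one (isCompact_hitSet hC).measurableSet]
  refine lintegral_mono (indicator_le fun p hp => ?_)
  have h1 : (1 : ℕ∞) ≤ (C ∩ hyperplane p.1 p.2).encard := one_le_encard_iff_nonempty.2 hp
  simpa [hyperplaneCount] using ENat.toENNReal_le.2 h1

namespace IsArcLengthParam

variable {d : ℕ} {f : C(unitInterval, EucSpace d)} {L : ℝ} {g : ℝ → EucSpace d}
  {ℓ : unitInterval → ℝ}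

lemma hausdorffMeasure_inter_eq_zero (h : IsArcLengthParam f L g ℓ)
    (hL : Measure.hausdorffMeasure 1 (range f) = curveLength f) (hf : IsRectifiable f)
    (q : unitInterval) :
    Measure.hausdorffMeasure 1 (f '' Icc 0 q ∩ f '' Icc q 1) = 0 := by
  have hm : MeasurableSet (f '' Icc q 1) := (isCompact_Icc.image f.continuous).measurableSet
  have hu : f '' Icc 0 q ∪ f '' Icc q 1 = range f := by
    rw [← image_union, Icc_union_Icc_eq_Icc unitInterval.nonneg' unitInterval.le_one',
      ← image_univ]
    congr 1
    ext t
    simp [unitInterval.le_one']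
  have h1 := measure_union_add_inter (μ := Measure.hausdorffMeasure 1) (f '' Icc 0 q) hm
  have h2 := eVariationOn.Icc_add_Icc f (s := univ) (unitInterval.nonneg' (t := q))
    (unitInterval.le_one' (t := q)) (mem_univ q)
  simp only [univ_inter] at h2
  -- The two arcs have total Hausdorff measure at most the length, which the union already attains.
  -- Finiteness of the length permits cancellation.
  have h3 : curveLength f + Measure.hausdorffMeasure 1 (f '' Icc 0 q ∩ f '' Icc q 1) ≤
      curveLength f + 0 := by
    rw [← hL, ← hu, h1, hu, hL, add_zero]
    refine (add_le_add (h.hausdorffMeasure_image_Icc_le unitInterval.nonneg')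
      (h.hausdorffMeasure_image_Icc_le unitInterval.le_one')).trans ?_
    rw [h2]
    exact eVariationOn.mono f (subset_univ _)
  exact le_antisymm ((ENNReal.add_le_add_iff_left hf.ne).1 h3) bot_le

lemma ae_encard_preimage_eq_one (h : IsArcLengthParam f L g ℓ)
    (hL : Measure.hausdorffMeasure 1 (range f) = curveLength f) (hf : IsRectifiable f) :
    ∀ᵐ y ∂((Measure.hausdorffMeasure 1).restrict (range f)), (f ⁻¹' {y}).encard = 1 := by
  rw [ae_restrict_iff' (isCompact_range f.continuous).measurableSet]
  obtain ⟨D, hDc, hD⟩ := TopologicalSpace.exists_countable_dense unitInterval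
  have hae := (ae_ball_iff hDc).2 fun q _ =>
    measure_eq_zero_iff_ae_notMem.1 (h.hausdorffMeasure_inter_eq_zero hL hf q)
  filter_upwards [hae] with y hy hyf
  refine le_antisymm (encard_le_one_iff.2 ?_) (one_le_encard_iff_nonempty.2 hyf)
  intro s t hs ht
  wlog hst : s ≤ t generalizing s t
  · exact (this t s ht hs (le_of_not_ge hst)).symm
  by_contra hne
  -- A point visited at times `s < t` lies on both arcs cut at any `q` between them; a countable
  -- dense set of `q` suffices.
  obtain ⟨q, hq, hsq, hqt⟩ := hD.exists_between (lt_of_le_of_ne hst hne)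
  exact hy q hq ⟨⟨s, ⟨unitInterval.nonneg', hsq.le⟩, hs⟩, ⟨t, ⟨hqt.le, unitInterval.le_one'⟩, ht⟩⟩

end IsArcLengthParam

end Multiplicity

/-! ### Assembly -/

theorem lemma2 {d : ℕ} [NeZero d] (f : C(unitInterval, EucSpace d)) (hf : IsRectifiable f) :
    ∃ γ : Measure (EucSpace d),
      -- `γ` is the measure on `Im f` given by the Crofton formula, whose integrand is measurable
      -- for the completed product sigma-algebra
      (∀ A : Set (EucSpace d), MeasurableSet A → A ⊆ Set.range f →
        AEMeasurable (fun p : UnitSphere d × ℝ => hyperplaneCount A p.1 p.2)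
          ((surfaceMeasure d).prod (volume.restrict (Set.Ici (0 : ℝ)))) ∧
        γ A = croftonIntegral A) ∧
      γ (Set.range f)ᶜ = 0 ∧
      -- domination of the trace of the Hausdorff measure
      (Measure.hausdorffMeasure 1).restrict (Set.range f) ≤ γ ∧
      -- the case where the Hausdorff measure of the image is the length
      (Measure.hausdorffMeasure 1 (Set.range f) = curveLength f →
        (Measure.hausdorffMeasure 1).restrict (Set.range f) = γ ∧
        ∀ᵐ y ∂((Measure.hausdorffMeasure 1).restrict (Set.range f)),
          (f ⁻¹' {y}).encard = 1) := by
  obtain ⟨L, g, ℓ, -, hLlen, h⟩ := exists_isArcLengthParam f hf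
  have hK : IsCompact (range f) := isCompact_range f.continuous
  have hK' : Measure.hausdorffMeasure 1 (range f) ≠ ∞ :=
    (h.hausdorffMeasure_range_le.trans_lt ENNReal.ofReal_lt_top).ne
  obtain ⟨γ, hγ⟩ := exists_croftonMeasure hK hK'
  have hc0 := croftonConst_ne_zero d
  have hct := croftonConst_ne_top d
  have hcount := fun A hA hAK => aemeasurable_hyperplaneCount_and_le (A := A) hK hK' hA hAK
  -- This crude constant serves only to provide a bounded density.
  have hbound : γ ≤ ((croftonConst d)⁻¹ * surfaceMeasure d univ).toNNReal •
      (Measure.hausdorffMeasure 1).restrict (range f) := by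
    refine Measure.le_iff.2 fun B hB => ?_
    rw [hγ B hB, Measure.smul_apply, ENNReal.smul_def, smul_eq_mul, ENNReal.coe_toNNReal
      (ENNReal.mul_ne_top (ENNReal.inv_ne_top.2 hc0) (measure_ne_top _ _)),
      Measure.restrict_apply hB, mul_assoc]
    gcongr
    exact (hcount _ (hB.inter hK.measurableSet) inter_subset_right).2
  have harc : ∀ s t, s ≤ t → edist (f s) (f t) ≤ γ (f '' Icc s t) := by
    intro s t hst
    have hC : IsCompact (f '' Icc s t) := isCompact_Icc.image f.continuous
    rw [hγ _ hC.measurableSet, inter_eq_left.2 (image_subset_range _ _),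
      ← ENNReal.mul_le_iff_le_inv hc0 hct]
    refine (lower_bound_lineMeasure_hitSet hC (isPreconnected_Icc.image _ f.continuous.continuousOn)
      (mem_image_of_mem _ (left_mem_Icc.2 hst)) (mem_image_of_mem _ (right_mem_Icc.2 hst))).trans ?_
    exact lineMeasure_hitSet_le_lintegral_hyperplaneCount hC
  have hle := h.restrict_hausdorffMeasure_le hbound harc
  refine ⟨γ, fun A hA hAK => ⟨(hcount A hA hAK).1, ?_⟩, ?_, hle, fun hL => ⟨?_, ?_⟩⟩
  · rw [hγ A hA, inter_eq_left.2 hAK,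
      croftonIntegral_eq_lintegral_lineMeasure (hcount A hA hAK).1]
  · rw [hγ _ hK.measurableSet.compl, compl_inter_self]
    simp [hyperplaneCount]
  · have : IsFiniteMeasure ((Measure.hausdorffMeasure 1).restrict (range f)) :=
      ⟨by simpa using hK'.lt_top⟩
    refine Measure.eq_of_le_of_measure_univ_eq hle (le_antisymm (hle _) ?_)
    rw [hγ _ .univ, univ_inter, Measure.restrict_apply_univ, hL, ← hLlen,
      ENNReal.inv_mul_le_iff hc0 hct]
    exact h.lintegral_hyperplaneCount_range_le
  · exact h.ae_encard_preimage_eq_one hL hf
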